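/- For complex numbers $a_1,\ldots,a_n$ ($n\ge 1$), the $n\times n$ weighted shift matrix with weights $a_1,\ldots,a_n$ is the matrix whose $(j,j+1)$ entry is $a_j$ for $1\le j\le n-1$, whose $(n,1)$ entry is $a_n$, and whose other entries are $0$ (for $n=1$ it is $[a_1]$). For a complex matrix $M=[m_{ij}]$ let $|M|=[|m_{ij}|]$ be its entrywise absolute value. Two $n\times n$ matrices $A,B$ are unitarily equivalent if $B=U^*AU$ for some unitary $U$. **Theorem 2.4.** Let $m\ge 3$, let $k_1,\ldots,k_m\ge 1$, let $n=\sum_{i=1}^m k_i$, and let $A=A_1\oplus\cdots\oplus A_m$, where each $A_i$ is a $k_i\times k_i$ weighted shift matrix with weights $a^{(i)}_1,\ldots,a^{(i)}_{k_i-1},0$ and $a^{(i)}_j\ne 0$ for all $1\le j\le k_i-1$. Let $B$ be an $n\times n$ weighted shift matrix with weights $b_1,\ldots,b_n$. 1. If $b_n=0$, then $B$ is unitarily equivalent to $A$ if and only if $|B|=|A_{\tau(1)}|\oplus\cdots\oplus|A_{\tau(m)}|$ for some permutation $\tau$ of $\{1,\ldots,m\}$. 2. For arbitrary $b_1,\ldots,b_n$,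 $B$ is unitarily equivalent to $A$ if and only if there are $s\in\{0,\ldots,n-1\}$ and a permutation $\tau$ of $\{1,\ldots,m\}$ such that $|B^{(s)}|=|A_{\tau(1)}|\oplus\cdots\oplus|A_{\tau(m)}|$, where $B^{(s)}$ is the $n\times n$ weighted shift matrix with weights $b_{1+s},\ldots,b_{n+s}$ (indices modulo $n$). -/

import Mathlib

/-- The `n`-by-`n` weighted shift matrix with weights `a 0, …, a (n-1)`: row `i` has the entry `a i`
in column `i + 1 (mod n)` and zeros elsewhere. In particular the last weight `a (n-1)` is
the entry in the lower left corner. For `n = 1` this is the matrix `[a 0]`. -/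
def weightedShift {n : ℕ} (a : Fin n → ℂ) : Matrix (Fin n) (Fin n) ℂ :=
  Matrix.of fun i j => if (j : ℕ) = ((i : ℕ) + 1) % n then a i else 0

/-- Rotation of a sequence of weights: the `j`-th term is `b (j + s)`, indices modulo `n`. -/
def rotateWeights {n : ℕ} (b : Fin n → ℂ) (s : ℕ) : Fin n → ℂ :=
  fun j => b ⟨((j : ℕ) + s) % n, Nat.mod_lt _ j.pos⟩

/-- The direct sum `M₁ ⊕ ⋯ ⊕ Mₘ` of square matrices of sizes `k 0, …, k (m-1)`, as a matrix of
size `n = ∑ k i`: the blocks stand along the diagonal in the given order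
(`finSigmaFinEquiv` is the lexicographic numbering of the pairs (block, position in the block)). -/
def matrixDirectSum {R : Type*} [Zero R] {m n : ℕ} {k : Fin m → ℕ} (h : ∑ i, k i = n)
    (M : ∀ i, Matrix (Fin (k i)) (Fin (k i)) R) : Matrix (Fin n) (Fin n) R :=
  Matrix.reindex (finSigmaFinEquiv.trans (finCongr h)) (finSigmaFinEquiv.trans (finCongr h))
    (Matrix.blockDiagonal' M)

/-- The entrywise absolute value `[|a_ij|]` of a complex matrix (not the operator `(A* A)^(1/2)`). -/
noncomputable def entrywiseAbs {n : ℕ} (A : Matrix (Fin n) (Fin n) ℂ) : Matrix (Fin n) (Fin n) ℝ :=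
  A.map fun z => ‖z‖

/-- `B` is unitarily equivalent to `A`: `B = U* A U` for some unitary matrix `U`. -/
def UnitarilyEquivalent {n : ℕ} (B A : Matrix (Fin n) (Fin n) ℂ) : Prop :=
  ∃ U ∈ Matrix.unitaryGroup (Fin n) ℂ, B = star U * A * U

/-! Since every block ends in a zero weight, A is itself a weighted shift, with the weights of the
blocks concatenated (`matrixDirectSum_weightedShift`). For a shift W with weights b (indices mod n),
W*W and all W^p (W*)^p are diagonal, with entries |b_{i-1}|² and |b_i ⋯ b_{i+p-1}|². So the common
kernel of W*W and the W^p (W*)^p - c_p has as dimension the number of indices i that follow a zero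
weight and have the c_p as their products. This number is a unitary invariant (`card_profile_eq`).
The products determine the moduli up to the first zero, so equivalent shifts have the same blocks up
to order and phases (`exists_perm_norm_eq`).

Conversely, a diagonal unitary corrects the phases when the last weight is zero, and permutation
matrices reorder blocks. In part 2 some weight of B must vanish, and a cyclic permutation moves it
to the last place. -/

open Matrix

/-! ### Unitary equivalence and matrices that transform with it -/

section UnitaryEquivalence

variable {n : ℕ}

theorem UnitarilyEquivalent.symm {A B : Matrix (Fin n) (Fin n) ℂ}
    (h : UnitarilyEquivalent B A) : UnitarilyEquivalent A B := by
  obtain ⟨U, hU, rfl⟩ := h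
  have h1 : U * star U = 1 := (Matrix.mem_unitaryGroup_iff).1 hU
  refine ⟨star U, Unitary.star_mem hU, ?_⟩
  rw [star_star, show U * (star U * A * U) * star U = (U * star U) * A * (U * star U) by
    simp only [Matrix.mul_assoc], h1, Matrix.one_mul, Matrix.mul_one]

theorem UnitarilyEquivalent.trans {A B C : Matrix (Fin n) (Fin n) ℂ}
    (h : UnitarilyEquivalent C B) (h' : UnitarilyEquivalent B A) : UnitarilyEquivalent C A := by
  obtain ⟨U, hU, rfl⟩ := h
  obtain ⟨V, hV, rfl⟩ := h'
  exact ⟨V * U, mul_mem hV hU, by simp only [star_mul, Matrix.mul_assoc]⟩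

/-- Conjugation by a permutation matrix times a diagonal unitary matrix. -/
theorem unitarilyEquivalent_of_entries {A B : Matrix (Fin n) (Fin n) ℂ}
    (e : Equiv.Perm (Fin n)) (d : Fin n → ℂ) (hd : ∀ i, ‖d i‖ = 1)
    (h : ∀ i j, B i j = star (d i) * A (e i) (e j) * d j) : UnitarilyEquivalent B A := by
  have hdd : ∀ i, star (d i) * d i = 1 := fun i => by
    have := Complex.conj_mul' (d i)
    rw [hd i] at this
    simpa using this
  refine ⟨(Matrix.diagonal d).submatrix e.symm id, ?_, ?_⟩
  · rw [Matrix.mem_unitaryGroup_iff']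
    ext i j
    simp only [Matrix.mul_apply, Matrix.star_apply, Matrix.submatrix_apply, id]
    rw [← Equiv.sum_comp e]
    simp only [Equiv.symm_apply_apply, Matrix.diagonal_apply, Matrix.one_apply]
    rw [Finset.sum_eq_single i]
    · by_cases hij : i = j
      · subst hij; simpa using hdd i
      · simp [hij]
    · intro b _ hb; simp [hb]
    · simp
  · ext i j
    rw [h]
    have h1 : ∀ y, (star ((Matrix.diagonal d).submatrix e.symm id) * A) i y
        = star (d i) * A (e i) y := by
      intro y
      simp only [Matrix.mul_apply, Matrix.star_apply, Matrix.submatrix_apply, id]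
      rw [← Equiv.sum_comp e, Finset.sum_eq_single i]
      · simp
      · intro b _ hb; simp [hb]
      · simp
    rw [Matrix.mul_apply, ← Equiv.sum_comp e, Finset.sum_eq_single j]
    · simp [h1]
    · intro b _ hb; simp [hb]
    · simp

/-- The matrices `W ^ p * (W*) ^ p`. -/
noncomputable def powMulStarPow (A : Matrix (Fin n) (Fin n) ℂ) : ℕ → Matrix (Fin n) (Fin n) ℂ
  | 0 => 1
  | p + 1 => A * powMulStarPow A p * star A

theorem powMulStarPow_conj {A U : Matrix (Fin n) (Fin n) ℂ} (hU : U ∈ Matrix.unitaryGroup (Fin n) ℂ)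
    (p : ℕ) : powMulStarPow (star U * A * U) p = star U * powMulStarPow A p * U := by
  have h1 : U * star U = 1 := (Matrix.mem_unitaryGroup_iff).1 hU
  have h2 : star U * U = 1 := (Matrix.mem_unitaryGroup_iff').1 hU
  induction p with
  | zero => simp [powMulStarPow, h2]
  | succ p ih =>
    rw [powMulStarPow, ih, powMulStarPow]
    simp only [star_mul, star_star]
    calc _ = star U * A * (U * star U) * powMulStarPow A p * (U * star U) * star A * U := by
          simp only [Matrix.mul_assoc]
      _ = _ := by rw [h1]; simp only [Matrix.mul_assoc, Matrix.one_mul]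

/-- A matrix whose kernel is spanned by the first vectors of the blocks with profile `c`. -/
noncomputable def profileMatrix (A : Matrix (Fin n) (Fin n) ℂ) (N : ℕ) (c : Fin N → ℝ) :
    Matrix (Fin n) (Fin n) ℂ :=
  star A * A + ∑ p : Fin N, (powMulStarPow A p - (c p : ℂ) • 1) * (powMulStarPow A p - (c p : ℂ) • 1)

theorem profileMatrix_conj {A U : Matrix (Fin n) (Fin n) ℂ} (hU : U ∈ Matrix.unitaryGroup (Fin n) ℂ)
    (N : ℕ) (c : Fin N → ℝ) :
    profileMatrix (star U * A * U) N c = star U * profileMatrix A N c * U := by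
  have h1 : U * star U = 1 := (Matrix.mem_unitaryGroup_iff).1 hU
  have h2 : star U * U = 1 := (Matrix.mem_unitaryGroup_iff').1 hU
  have key : ∀ X Y : Matrix (Fin n) (Fin n) ℂ,
      (star U * X * U) * (star U * Y * U) = star U * (X * Y) * U := by
    intro X Y
    calc _ = star U * X * (U * star U) * Y * U := by simp only [Matrix.mul_assoc]
      _ = _ := by rw [h1]; simp only [Matrix.mul_assoc, Matrix.one_mul]
  have h3 : ∀ p : Fin N, powMulStarPow (star U * A * U) p - (c p : ℂ) • 1
      = star U * (powMulStarPow A p - (c p : ℂ) • 1) * U := by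
    intro p
    rw [powMulStarPow_conj hU, Matrix.mul_sub, Matrix.sub_mul]
    simp [h2]
  have h4 : star (star U * A * U) = star U * star A * U := by
    simp only [star_mul, star_star, Matrix.mul_assoc]
  simp only [profileMatrix, h3, h4, key]
  rw [Matrix.mul_add, Matrix.add_mul, Matrix.mul_sum, Matrix.sum_mul]

theorem rotateWeights_apply (b : Fin n → ℂ) (s j : Fin n) :
    rotateWeights b s j = b (j + s) := by
  simp only [rotateWeights]
  congr 1

end UnitaryEquivalence

/-! ### Weighted shifts: phases and profiles -/

section Shift

variable {n : ℕ} [NeZero n]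

theorem Fin.val_add_one_mod (i : Fin n) : ((i + 1 : Fin n) : ℕ) = ((i : ℕ) + 1) % n := by
  rw [Fin.val_add, Fin.val_one', Nat.add_mod_mod]

theorem weightedShift_apply (b : Fin n → ℂ) (i j : Fin n) :
    weightedShift b i j = if j = i + 1 then b i else 0 := by
  simp only [weightedShift, Matrix.of_apply, Fin.ext_iff, Fin.val_add_one_mod]

theorem weightedShift_rotateWeights_unitarilyEquivalent (b : Fin n → ℂ) (s : Fin n) :
    UnitarilyEquivalent (weightedShift (rotateWeights b s)) (weightedShift b) := by
  refine unitarilyEquivalent_of_entries (Equiv.addRight s) (fun _ => 1) (by simp) ?_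
  intro i j
  simp only [weightedShift_apply, rotateWeights_apply, Equiv.coe_addRight, star_one, one_mul,
    mul_one]
  have : j = i + 1 ↔ j + s = i + s + 1 := by
    rw [add_right_comm, add_left_inj]
  simp only [this]

theorem entrywiseAbs_weightedShift_eq_iff (b c : Fin n → ℂ) :
    entrywiseAbs (weightedShift b) = entrywiseAbs (weightedShift c) ↔ ∀ i, ‖b i‖ = ‖c i‖ := by
  constructor
  · intro h i
    have := congrFun (congrFun h i) (i + 1)
    simpa [entrywiseAbs, weightedShift_apply] using this
  · intro h
    ext i j
    simp only [entrywiseAbs, Matrix.map_apply, weightedShift_apply]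
    split_ifs
    · exact h i
    · rfl

/-- Phases that transform the weights `c` into the weights `b`. -/
noncomputable def shiftPhase (b c : Fin n → ℂ) : ℕ → ℂ
  | 0 => 1
  | i + 1 => if c (Fin.ofNat n i) = 0 then 1 else
      shiftPhase b c i * b (Fin.ofNat n i) / c (Fin.ofNat n i)

theorem norm_shiftPhase {b c : Fin n → ℂ} (h : ∀ i, ‖b i‖ = ‖c i‖) (i : ℕ) :
    ‖shiftPhase b c i‖ = 1 := by
  induction i with
  | zero => simp [shiftPhase]
  | succ i ih =>
    rw [shiftPhase]
    split_ifs with hc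
    · simp
    · rw [norm_div, norm_mul, ih, h, one_mul, div_self (norm_ne_zero_iff.2 hc)]

theorem val_add_one_of_ne_zero {b : Fin n → ℂ} (hb : ∀ j : Fin n, (j : ℕ) + 1 = n → b j = 0)
    {i : Fin n} (hi : b i ≠ 0) : ((i + 1 : Fin n) : ℕ) = (i : ℕ) + 1 := by
  rw [Fin.val_add_one_mod, Nat.mod_eq_of_lt]
  have := mt (hb i) hi
  omega

/-- The phases must satisfy d_{i+1} = d_i b_i / c_i wherever c_i ≠ 0. The zero last weight removes
the condition that would close the cycle, so the recursion has no obstruction. -/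
theorem weightedShift_unitarilyEquivalent_of_norm_eq {b c : Fin n → ℂ}
    (h : ∀ i, ‖b i‖ = ‖c i‖) (hb : ∀ j : Fin n, (j : ℕ) + 1 = n → b j = 0) :
    UnitarilyEquivalent (weightedShift b) (weightedShift c) := by
  refine unitarilyEquivalent_of_entries (Equiv.refl _) (fun i => shiftPhase b c i)
    (fun i => norm_shiftPhase h i) ?_
  intro i j
  simp only [weightedShift_apply, Equiv.refl_apply]
  split_ifs with hj
  · subst hj
    by_cases hi : b i = 0
    · have : c i = 0 := by rw [← norm_eq_zero, ← h, hi, norm_zero]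
      simp [hi, this]
    · have hc : c i ≠ 0 := by rwa [← norm_ne_zero_iff, ← h, norm_ne_zero_iff]
      have hof : Fin.ofNat n (i : ℕ) = i := by simp
      rw [val_add_one_of_ne_zero hb hi, shiftPhase, hof, if_neg hc]
      have := Complex.conj_mul' (shiftPhase b c i)
      rw [norm_shiftPhase h] at this
      have h2 : star (shiftPhase b c i) * shiftPhase b c i = 1 := by simpa using this
      field_simp
      exact h2.symm
  · simp

/-- The diagonal entries of `W ^ p * (W*) ^ p` for the weighted shift matrix `W`. -/
noncomputable def shiftProfile (b : Fin n → ℂ) : ℕ → Fin n → ℝ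
  | 0, _ => 1
  | p + 1, i => ‖b i‖ ^ 2 * shiftProfile b p (i + 1)

theorem powMulStarPow_weightedShift (b : Fin n → ℂ) (p : ℕ) :
    powMulStarPow (weightedShift b) p = diagonal fun i => (shiftProfile b p i : ℂ) := by
  induction p with
  | zero => simp [powMulStarPow, shiftProfile]
  | succ p ih =>
    rw [powMulStarPow, ih]
    ext i j
    rw [Matrix.mul_apply]
    simp only [Matrix.mul_diagonal, Matrix.star_apply, weightedShift_apply, shiftProfile]
    rw [Finset.sum_eq_single (i + 1)]
    · by_cases hij : i = j
      · subst hij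
        have := Complex.mul_conj' (b i)
        simp only [if_true, Matrix.diagonal_apply_eq, Complex.star_def]
        push_cast
        rw [← this]; ring
      · simp [hij]
    · intro y _ hy; simp [hy]
    · simp

theorem star_mul_weightedShift (b : Fin n → ℂ) :
    star (weightedShift b) * weightedShift b = diagonal fun i => ((‖b (i - 1)‖ ^ 2 : ℝ) : ℂ) := by
  ext i j
  simp only [Matrix.mul_apply, Matrix.star_apply, weightedShift_apply]
  rw [Finset.sum_eq_single (i - 1)]
  · by_cases hij : i = j
    · subst hij
      have := Complex.conj_mul' (b (i - 1))
      simpa using this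
    · simp [hij, Ne.symm hij]
  · intro y _ hy
    have : ¬ i = y + 1 := fun h => hy (by rw [h, add_sub_cancel_right])
    simp [this]
  · simp

theorem profileMatrix_weightedShift (b : Fin n → ℂ) (N : ℕ) (c : Fin N → ℝ) :
    profileMatrix (weightedShift b) N c = diagonal fun i =>
      ((‖b (i - 1)‖ ^ 2 + ∑ p : Fin N, (shiftProfile b p i - c p) ^ 2 : ℝ) : ℂ) := by
  have h : ∀ p : Fin N, (powMulStarPow (weightedShift b) p - (c p : ℂ) • 1) *
      (powMulStarPow (weightedShift b) p - (c p : ℂ) • 1) =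
      diagonal fun i => (((shiftProfile b p i - c p) ^ 2 : ℝ) : ℂ) := by
    intro p
    rw [powMulStarPow_weightedShift, ← Matrix.diagonal_one, ← Matrix.diagonal_smul,
      Matrix.diagonal_sub, Matrix.diagonal_mul_diagonal]
    congr 1
    ext i
    simp [sq]
  rw [profileMatrix, star_mul_weightedShift]
  simp only [h]
  ext i j
  rw [Matrix.add_apply, Matrix.sum_apply]
  by_cases hij : i = j
  · subst hij; simp
  · simp [hij]

/-- Both sides are nullities of profile matrices. These are diagonal with sums of real squares as
entries, and unitary conjugation preserves their rank. -/
theorem card_profile_eq {b c : Fin n → ℂ}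
    (h : UnitarilyEquivalent (weightedShift b) (weightedShift c)) (N : ℕ) (f : Fin N → ℝ) :
    Nat.card {i // b (i - 1) = 0 ∧ ∀ p : Fin N, shiftProfile b p i = f p} =
      Nat.card {i // c (i - 1) = 0 ∧ ∀ p : Fin N, shiftProfile c p i = f p} := by
  classical
  have key : ∀ b : Fin n → ℂ, Nat.card {i // b (i - 1) = 0 ∧ ∀ p : Fin N, shiftProfile b p i = f p}
      = n - (profileMatrix (weightedShift b) N f).rank := by
    intro b
    rw [profileMatrix_weightedShift, Matrix.rank_diagonal]
    have hc := Fintype.card_subtype_compl (fun i : Fin n =>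
      ((‖b (i - 1)‖ ^ 2 + ∑ p : Fin N, (shiftProfile b p i - f p) ^ 2 : ℝ) : ℂ) ≠ 0)
    rw [Fintype.card_fin] at hc
    rw [← hc, ← Nat.card_eq_fintype_card]
    refine Nat.card_congr (Equiv.subtypeEquivRight fun i => ?_)
    rw [not_not, Complex.ofReal_eq_zero,
      add_eq_zero_iff_of_nonneg (by positivity) (Finset.sum_nonneg fun _ _ => sq_nonneg _),
      Finset.sum_eq_zero_iff_of_nonneg (fun _ _ => sq_nonneg _)]
    simp [sub_eq_zero]
  obtain ⟨U, hU, hUU⟩ := h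
  rw [key, key, hUU, profileMatrix_conj hU]
  have hdet : IsUnit U.det := (Matrix.isUnit_iff_isUnit_det U).1
    (IsUnit.of_mul_eq_one _ ((Matrix.mem_unitaryGroup_iff).1 hU))
  have hdet' : IsUnit (star U).det := (Matrix.isUnit_iff_isUnit_det _).1
    (IsUnit.of_mul_eq_one _ ((Matrix.mem_unitaryGroup_iff').1 hU))
  rw [Matrix.rank_mul_eq_left_of_isUnit_det _ _ hdet,
    Matrix.rank_mul_eq_right_of_isUnit_det _ _ hdet']

/-- Fibres of the profile map have equal cardinality on both sides; bijections between them are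
glued. -/
theorem exists_equiv_profile_eq {b c : Fin n → ℂ}
    (h : UnitarilyEquivalent (weightedShift b) (weightedShift c)) (N : ℕ) :
    ∃ φ : {i // b (i - 1) = 0} ≃ {i // c (i - 1) = 0},
      ∀ x : {i // b (i - 1) = 0}, ∀ p < N, shiftProfile b p x = shiftProfile c p (φ x) := by
  let F : ∀ b : Fin n → ℂ, {i // b (i - 1) = 0} → (Fin N → ℝ) :=
    fun b x p => shiftProfile b p x
  have hF : ∀ (b : Fin n → ℂ) f, Nat.card {x // F b x = f} =
      Nat.card {i // b (i - 1) = 0 ∧ ∀ p : Fin N, shiftProfile b p i = f p} := by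
    intro b f
    refine Nat.card_congr (Equiv.trans (Equiv.subtypeEquivRight fun x => ?_)
      (Equiv.subtypeSubtypeEquivSubtypeInter (fun i => b (i - 1) = 0)
        (fun i => ∀ p : Fin N, shiftProfile b p i = f p)))
    exact funext_iff
  have hE : ∀ f, Nonempty ({x // F b x = f} ≃ {x // F c x = f}) := by
    intro f
    exact (Finite.card_eq).1 (by rw [hF, hF]; exact card_profile_eq h N f)
  let E := fun f => (hE f).some
  refine ⟨(Equiv.sigmaFiberEquiv (F b)).symm.trans
    ((Equiv.sigmaCongrRight E).trans (Equiv.sigmaFiberEquiv (F c))), ?_⟩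
  intro x p hp
  have := (E (F b x) ⟨x, rfl⟩).2
  exact (congrFun this ⟨p, hp⟩).symm

theorem norm_eq_of_profile_eq {b c : Fin n → ℂ} {x y : Fin n} {N : ℕ}
    (h : ∀ p < N + 2, shiftProfile b p x = shiftProfile c p y) : ‖b x‖ = ‖c y‖ := by
  have := h 1 (by omega)
  simp only [shiftProfile, mul_one] at this
  exact (sq_eq_sq₀ (norm_nonneg _) (norm_nonneg _)).1 this

/-- Cancelling the common nonzero first factor costs one unit of profile length. -/
theorem profile_succ_eq_of_profile_eq {b c : Fin n → ℂ} {x y : Fin n} {N : ℕ}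
    (h : ∀ p < N + 2, shiftProfile b p x = shiftProfile c p y) (hc : c y ≠ 0) :
    ∀ p < N + 1, shiftProfile b p (x + 1) = shiftProfile c p (y + 1) := by
  intro p hp
  have h1 := h (p + 1) (by omega)
  simp only [shiftProfile, norm_eq_of_profile_eq h] at h1
  exact mul_left_cancel₀ (pow_ne_zero _ (norm_ne_zero_iff.2 hc)) h1

end Shift

/-! ### Direct sums as weighted shifts, and the matching of blocks -/

section DirectSum

variable {m n : ℕ} {k : Fin m → ℕ}

/-- The position at which the `i`-th block of a direct sum starts. -/
def blockStart (k : Fin m → ℕ) (i : Fin m) : ℕ := ∑ j : Fin (i : ℕ), k (Fin.castLE i.2.le j)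

theorem blockStart_succ (k : Fin m → ℕ) (i : ℕ) (hi : i + 1 < m) :
    blockStart k ⟨i + 1, hi⟩ = blockStart k ⟨i, by omega⟩ + k ⟨i, by omega⟩ := by
  simp only [blockStart]
  rw [Fin.sum_univ_castSucc]
  rfl

/-- The numbering of the pairs (block, position in the block). -/
def blockIndex (h : ∑ i, k i = n) : (Σ i, Fin (k i)) ≃ Fin n :=
  finSigmaFinEquiv.trans (finCongr h)

theorem blockIndex_val (h : ∑ i, k i = n) (i : Fin m) (q : Fin (k i)) :
    (blockIndex h ⟨i, q⟩ : ℕ) = blockStart k i + q := by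
  simp [blockIndex, blockStart, finSigmaFinEquiv_apply]

theorem matrixDirectSum_blockIndex {R : Type*} [Zero R] (h : ∑ i, k i = n)
    (M : ∀ i, Matrix (Fin (k i)) (Fin (k i)) R) (x y : Σ i, Fin (k i)) :
    matrixDirectSum h M (blockIndex h x) (blockIndex h y) = Matrix.blockDiagonal' M x y := by
  simp [matrixDirectSum, blockIndex]

theorem entrywiseAbs_matrixDirectSum (h : ∑ i, k i = n)
    (M : ∀ i, Matrix (Fin (k i)) (Fin (k i)) ℂ) :
    matrixDirectSum h (fun i => entrywiseAbs (M i)) = entrywiseAbs (matrixDirectSum h M) := by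
  ext x y
  obtain ⟨⟨i, q⟩, rfl⟩ := (blockIndex h).surjective x
  obtain ⟨⟨j, r⟩, rfl⟩ := (blockIndex h).surjective y
  rw [entrywiseAbs, Matrix.map_apply, matrixDirectSum_blockIndex, matrixDirectSum_blockIndex]
  by_cases hij : i = j
  · subst hij
    simp [Matrix.blockDiagonal'_apply_eq, entrywiseAbs]
  · simp [Matrix.blockDiagonal'_apply_ne _ _ _ hij]

theorem matrixDirectSum_perm_unitarilyEquivalent (h : ∑ i, k i = n) (τ : Equiv.Perm (Fin m))
    (h' : ∑ i, k (τ i) = n) (M : ∀ i, Matrix (Fin (k i)) (Fin (k i)) ℂ) :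
    UnitarilyEquivalent (matrixDirectSum h' fun i => M (τ i)) (matrixDirectSum h M) := by
  refine unitarilyEquivalent_of_entries ((blockIndex h').symm.trans
    ((Equiv.sigmaCongrLeft (β := fun i => Fin (k i)) τ).trans (blockIndex h)))
    (fun _ => 1) (by simp) ?_
  intro x y
  obtain ⟨⟨i, q⟩, rfl⟩ := (blockIndex h').surjective x
  obtain ⟨⟨j, r⟩, rfl⟩ := (blockIndex h').surjective y
  simp only [Equiv.trans_apply, Equiv.symm_apply_apply, matrixDirectSum_blockIndex, star_one,
    one_mul, mul_one]
  change _ = Matrix.blockDiagonal' M ⟨τ i, q⟩ ⟨τ j, r⟩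
  by_cases hij : i = j
  · subst hij
    simp [Matrix.blockDiagonal'_apply_eq]
  · rw [Matrix.blockDiagonal'_apply_ne _ _ _ hij,
      Matrix.blockDiagonal'_apply_ne _ _ _ (fun e => hij (τ.injective e))]

/-- The concatenation of the weights of the blocks. -/
def concatWeights (h : ∑ i, k i = n) (a : ∀ i, Fin (k i) → ℂ) : Fin n → ℂ :=
  fun x => a ((blockIndex h).symm x).1 ((blockIndex h).symm x).2

theorem concatWeights_blockIndex (h : ∑ i, k i = n) (a : ∀ i, Fin (k i) → ℂ) (i : Fin m)
    (q : Fin (k i)) : concatWeights h a (blockIndex h ⟨i, q⟩) = a i q := by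
  have : ∀ z : Σ i, Fin (k i), z = ⟨i, q⟩ → a z.1 z.2 = a i q := by
    rintro _ rfl; rfl
  exact this _ (Equiv.symm_apply_apply _ _)

theorem concatWeights_last (h : ∑ i, k i = n) {a : ∀ i, Fin (k i) → ℂ}
    (ha : ∀ (i : Fin m) (j : Fin (k i)), (j : ℕ) + 1 = k i → a i j = 0)
    (x : Fin n) (hx : (x : ℕ) + 1 = n) : concatWeights h a x = 0 := by
  obtain ⟨⟨i, q⟩, rfl⟩ := (blockIndex h).surjective x
  rw [concatWeights_blockIndex]
  refine ha i q ?_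
  by_contra hq
  have hq' : (q : ℕ) + 1 < k i := by have := q.2; omega
  have h1 := blockIndex_val h i q
  have h2 := blockIndex_val h i ⟨q + 1, hq'⟩
  have h3 := (blockIndex h ⟨i, ⟨q + 1, hq'⟩⟩).2
  simp only at h2
  omega

variable [NeZero n]

theorem blockIndex_add_one (h : ∑ i, k i = n) (i : Fin m) (q : ℕ) (hq : q + 1 < k i) :
    blockIndex h ⟨i, ⟨q, by omega⟩⟩ + 1 = blockIndex h ⟨i, ⟨q + 1, hq⟩⟩ := by
  have h1 := blockIndex_val h i ⟨q, by omega⟩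
  have h2 := blockIndex_val h i ⟨q + 1, hq⟩
  have h3 := (blockIndex h ⟨i, ⟨q + 1, hq⟩⟩).2
  rw [Fin.ext_iff, Fin.val_add_one_mod, Nat.mod_eq_of_lt] <;> simp only at * <;> omega

variable {a : ∀ i, Fin (k i) → ℂ}

/-- The two sides could differ only in the rows of last weights of blocks, and these rows are zero.
-/
theorem matrixDirectSum_weightedShift (h : ∑ i, k i = n)
    (ha : ∀ (i : Fin m) (j : Fin (k i)), (j : ℕ) + 1 = k i → a i j = 0) :
    matrixDirectSum h (fun i => weightedShift (a i)) = weightedShift (concatWeights h a) := by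
  ext x y
  obtain ⟨⟨i, q⟩, rfl⟩ := (blockIndex h).surjective x
  obtain ⟨⟨j, r⟩, rfl⟩ := (blockIndex h).surjective y
  rw [matrixDirectSum_blockIndex, weightedShift_apply, concatWeights_blockIndex]
  by_cases hq : (q : ℕ) + 1 = k i
  · rw [ha i q hq, ite_self]
    by_cases hij : i = j
    · subst hij
      simp [Matrix.blockDiagonal'_apply_eq, weightedShift, ha i q hq]
    · rw [Matrix.blockDiagonal'_apply_ne _ _ _ hij]
  · have hq' : (q : ℕ) + 1 < k i := by have := q.2; omega
    rw [blockIndex_add_one h i q hq']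
    simp only [(blockIndex h).injective.eq_iff]
    by_cases hij : i = j
    · subst hij
      rw [Matrix.blockDiagonal'_apply_eq]
      simp [weightedShift, Nat.mod_eq_of_lt hq', Fin.ext_iff]
    · rw [Matrix.blockDiagonal'_apply_ne _ _ _ hij, if_neg]
      intro e
      exact hij (congrArg Sigma.fst e).symm

/-- The blocks correspond to the positions that follow a zero weight. -/
theorem exists_equiv_blockStart (h : ∑ i, k i = n) (hk : ∀ i, 1 ≤ k i)
    (ha_last : ∀ (i : Fin m) (j : Fin (k i)), (j : ℕ) + 1 = k i → a i j = 0)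
    (ha_ne : ∀ (i : Fin m) (j : Fin (k i)), (j : ℕ) + 1 < k i → a i j ≠ 0) :
    ∃ γ : Fin m ≃ {y // concatWeights h a (y - 1) = 0},
      ∀ i, (γ i : Fin n) = blockIndex h ⟨i, ⟨0, hk i⟩⟩ := by
  have hz : ∀ i, concatWeights h a (blockIndex h ⟨i, ⟨0, hk i⟩⟩ - 1) = 0 := by
    intro i
    obtain ⟨⟨j, r⟩, hr⟩ := (blockIndex h).surjective (blockIndex h ⟨i, ⟨0, hk i⟩⟩ - 1)
    rw [← hr, concatWeights_blockIndex]
    refine ha_last j r ?_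
    by_contra hq
    have hq' : (r : ℕ) + 1 < k j := by have := r.2; omega
    have h1 := blockIndex_add_one h j r hq'
    rw [Fin.eta, hr, sub_add_cancel] at h1
    have h2 := (blockIndex h).injective h1
    have h3 : ∀ x y : Σ i, Fin (k i), x = y → (x.2 : ℕ) = y.2 := by rintro _ _ rfl; rfl
    simpa using h3 _ _ h2
  refine ⟨Equiv.ofBijective (fun i => ⟨_, hz i⟩) ⟨?_, ?_⟩, fun i => rfl⟩
  · intro i j hij
    exact congrArg Sigma.fst ((blockIndex h).injective (congrArg Subtype.val hij))
  · rintro ⟨y, hy⟩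
    obtain ⟨⟨i, q, hq⟩, rfl⟩ := (blockIndex h).surjective y
    refine ⟨i, Subtype.ext ?_⟩
    cases q with
    | zero => rfl
    | succ q =>
      rw [← blockIndex_add_one h i q hq, add_sub_cancel_right, concatWeights_blockIndex] at hy
      exact absurd hy (ha_ne i _ hq)

theorem exists_perm_norm_eq (h : ∑ i, k i = n) (hk : ∀ i, 1 ≤ k i)
    (ha_last : ∀ (i : Fin m) (j : Fin (k i)), (j : ℕ) + 1 = k i → a i j = 0)
    (ha_ne : ∀ (i : Fin m) (j : Fin (k i)), (j : ℕ) + 1 < k i → a i j ≠ 0)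
    {b : Fin n → ℂ} (hb : ∀ j : Fin n, (j : ℕ) + 1 = n → b j = 0)
    (hU : UnitarilyEquivalent (weightedShift b) (weightedShift (concatWeights h a))) :
    ∃ τ : Equiv.Perm (Fin m), ∀ x,
      ‖b x‖ = ‖concatWeights ((Equiv.sum_comp τ k).trans h) (fun i => a (τ i)) x‖ := by
  classical
  -- Each step along a block uses up one length, and reading a modulus needs lengths 0 and 1; blocks
  -- have size at most n.
  obtain ⟨φ, hφ⟩ := exists_equiv_profile_eq hU (n + 2)
  obtain ⟨γ, hγ⟩ := exists_equiv_blockStart h hk ha_last ha_ne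
  have hcard : (Finset.univ.filter fun i => b (i - 1) = 0).card = m := by
    rw [← Fintype.card_subtype, Fintype.card_congr (φ.trans γ.symm), Fintype.card_fin]
  -- `o` lists the block starts of b in increasing order, which fixes the order of the blocks in
  -- `τ`.
  obtain ⟨o, hmem, hsurj⟩ : ∃ o : Fin m ↪o Fin n, (∀ j, b (o j - 1) = 0) ∧
      ∀ x, b (x - 1) = 0 → ∃ j, o j = x := by
    refine ⟨(Finset.univ.filter fun i => b (i - 1) = 0).orderEmbOfFin hcard, fun j =>
      (Finset.mem_filter.1 (Finset.orderEmbOfFin_mem _ hcard j)).2, fun x hx => ?_⟩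
    rw [← Set.mem_range, Finset.range_orderEmbOfFin]
    simpa using hx
  let ω : Fin m ≃ {x // b (x - 1) = 0} := Equiv.ofBijective (fun j => ⟨o j, hmem j⟩)
    ⟨fun i j hij => o.injective (Subtype.ext_iff.1 hij), fun ⟨x, hx⟩ =>
      (hsurj x hx).imp fun _ hj => Subtype.ext hj⟩
  let τ : Equiv.Perm (Fin m) := ω.trans (φ.trans γ.symm)
  have hτ : ∀ j, ∀ p < n + 2, shiftProfile b p (o j) =
      shiftProfile (concatWeights h a) p (blockIndex h ⟨τ j, ⟨0, hk _⟩⟩) := by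
    intro j p hp
    have h1 := hφ (ω j) p hp
    rw [← hγ, show γ (τ j) = φ (ω j) by simp [τ]]
    exact h1
  have hkn : ∀ i, k i ≤ n := fun i =>
    h ▸ Finset.single_le_sum (fun _ _ => Nat.zero_le _) (Finset.mem_univ i)
  have walk : ∀ j q (hq : q < k (τ j)), ∃ x : Fin n, (x : ℕ) = o j + q ∧
      ∀ p < (n - q) + 2, shiftProfile b p x =
        shiftProfile (concatWeights h a) p (blockIndex h ⟨τ j, ⟨q, hq⟩⟩) := by
    intro j q
    induction q with
    | zero => exact fun hq => ⟨o j, rfl, hτ j⟩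
    | succ q ih =>
      intro hq
      obtain ⟨x, hx, hp⟩ := ih (by omega)
      have hne : concatWeights h a (blockIndex h ⟨τ j, ⟨q, by omega⟩⟩) ≠ 0 := by
        rw [concatWeights_blockIndex]
        exact ha_ne _ _ hq
      have hbx : b x ≠ 0 := by
        rwa [← norm_ne_zero_iff, norm_eq_of_profile_eq hp, norm_ne_zero_iff]
      refine ⟨x + 1, by rw [val_add_one_of_ne_zero hb hbx, hx]; ring, ?_⟩
      rw [← blockIndex_add_one h (τ j) q hq]
      have := hkn (τ j)
      rw [show n - (q + 1) + 2 = (n - q) + 1 by omega]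
      exact profile_succ_eq_of_profile_eq hp hne
  have hnorm : ∀ j (q : Fin (k (τ j))), ∃ x : Fin n, (x : ℕ) = o j + q ∧ ‖b x‖ = ‖a (τ j) q‖ := by
    intro j q
    obtain ⟨x, hx, hp⟩ := walk j q q.2
    refine ⟨x, hx, ?_⟩
    rw [norm_eq_of_profile_eq hp, concatWeights_blockIndex]
  have hstart : ∀ j (hj : j < m), ((o ⟨j, hj⟩ : Fin n) : ℕ) =
      blockStart (fun i => k (τ i)) ⟨j, hj⟩ := by
    intro j
    induction j with
    | zero =>
      intro hj
      -- Index 0 cyclically follows the zero last weight, so it is a start, hence the first one.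
      obtain ⟨l, hl⟩ := hsurj 0 (hb _ (by
        have h1 := Fin.val_add_one_mod (0 - 1 : Fin n)
        rw [sub_add_cancel, Fin.val_zero] at h1
        have h2 := Nat.dvd_of_mod_eq_zero h1.symm
        have h3 := Nat.le_of_dvd (by omega) h2
        have h4 := (0 - 1 : Fin n).2
        omega))
      have h1 : o ⟨0, hj⟩ ≤ o l := o.monotone (Fin.mk_le_of_le_val (Nat.zero_le _))
      rw [hl, Fin.le_def, Fin.val_zero] at h1
      simp only [blockStart, Finset.univ_eq_empty, Finset.sum_empty]
      omega
    | succ j ih =>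
      intro hj
      have ihj := ih (by omega)
      rw [blockStart_succ, ← ihj]
      set j0 : Fin m := ⟨j, by omega⟩ with hj0
      have hlt : o j0 < o ⟨j + 1, hj⟩ := o.strictMono (by simp [hj0])
      rw [Fin.lt_def] at hlt
      have hk0 := hk (τ j0)
      -- A start inside the block would follow one of its nonzero weights.
      have lower : (o j0 : ℕ) + k (τ j0) ≤ o ⟨j + 1, hj⟩ := by
        by_contra hcon
        obtain ⟨q, hq⟩ := Nat.exists_eq_add_of_lt hlt
        have hqk : q + 1 < k (τ j0) := by omega
        obtain ⟨x, hx, hbx⟩ := hnorm j0 ⟨q, by omega⟩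
        have hb0 : b x ≠ 0 := by
          rw [← norm_ne_zero_iff, hbx, norm_ne_zero_iff]
          exact ha_ne _ _ hqk
        have hx1 := val_add_one_of_ne_zero hb hb0
        have hxo : x + 1 = o ⟨j + 1, hj⟩ := by
          rw [Fin.ext_iff, hx1, hx, hq]
        apply hb0
        have := hmem ⟨j + 1, hj⟩
        rwa [← hxo, add_sub_cancel_right] at this
      refine le_antisymm ?_ lower
      -- The block's last weight vanishes, so the next index is a start; `lower` rules out wrapping
      -- around.
      obtain ⟨x, hx, hbx⟩ := hnorm j0 ⟨k (τ j0) - 1, by omega⟩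
      rw [ha_last _ _ (by simp only; omega), norm_zero, norm_eq_zero] at hbx
      simp only at hx
      have hxv : ((x + 1 : Fin n) : ℕ) = o j0 + k (τ j0) := by
        have := (o ⟨j + 1, hj⟩).2
        rw [Fin.val_add_one_mod, Nat.mod_eq_of_lt] <;> omega
      obtain ⟨l, hl⟩ := hsurj (x + 1) (by rwa [add_sub_cancel_right])
      have hjl : j0 < l := by
        rw [← o.lt_iff_lt, hl, Fin.lt_def, hxv]
        omega
      have : o ⟨j + 1, hj⟩ ≤ o l := o.monotone hjl
      rw [hl, Fin.le_def, hxv] at this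
      exact this
  refine ⟨τ, fun x => ?_⟩
  obtain ⟨⟨j, q⟩, rfl⟩ := (blockIndex ((Equiv.sum_comp τ k).trans h)).surjective x
  obtain ⟨y, hy, hby⟩ := hnorm j q
  have hv := blockIndex_val ((Equiv.sum_comp τ k).trans h) j q
  rw [← hstart j j.2, ← hy] at hv
  have hxy := Fin.ext hv
  rw [concatWeights_blockIndex _ (fun i => a (τ i)), hxy, hby]

theorem unitarilyEquivalent_matrixDirectSum_iff (h : ∑ i, k i = n)
    (hk : ∀ i, 1 ≤ k i)
    (ha_last : ∀ (i : Fin m) (j : Fin (k i)), (j : ℕ) + 1 = k i → a i j = 0)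
    (ha_ne : ∀ (i : Fin m) (j : Fin (k i)), (j : ℕ) + 1 < k i → a i j ≠ 0)
    {b : Fin n → ℂ} (hb : ∀ j : Fin n, (j : ℕ) + 1 = n → b j = 0) :
    UnitarilyEquivalent (weightedShift b) (matrixDirectSum h fun i => weightedShift (a i)) ↔
      ∃ τ : Equiv.Perm (Fin m), ∀ x,
        ‖b x‖ = ‖concatWeights ((Equiv.sum_comp τ k).trans h) (fun i => a (τ i)) x‖ := by
  constructor
  · intro hU
    rw [matrixDirectSum_weightedShift h ha_last] at hU
    exact exists_perm_norm_eq h hk ha_last ha_ne hb hU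
  · rintro ⟨τ, hτ⟩
    have h1 := weightedShift_unitarilyEquivalent_of_norm_eq hτ hb
    rw [← matrixDirectSum_weightedShift _ (fun i => ha_last (τ i))] at h1
    exact h1.trans (matrixDirectSum_perm_unitarilyEquivalent h τ _ fun i => weightedShift (a i))

theorem entrywiseAbs_eq_matrixDirectSum_iff (h : ∑ i, k i = n)
    (ha_last : ∀ (i : Fin m) (j : Fin (k i)), (j : ℕ) + 1 = k i → a i j = 0) (b : Fin n → ℂ) :
    entrywiseAbs (weightedShift b) = matrixDirectSum h (fun i => entrywiseAbs (weightedShift (a i)))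
      ↔ ∀ x, ‖b x‖ = ‖concatWeights h a x‖ := by
  rw [entrywiseAbs_matrixDirectSum, matrixDirectSum_weightedShift h ha_last,
    entrywiseAbs_weightedShift_eq_iff]

end DirectSum

/-! ### The theorem, with part 2 reduced to part 1 by rotation -/

theorem theorem2p4 (m n : ℕ) (hm : 3 ≤ m) (k : Fin m → ℕ) (hk : ∀ i, 1 ≤ k i)
    (hn : ∑ i, k i = n)
    (a : ∀ i, Fin (k i) → ℂ)
    (ha_last : ∀ (i : Fin m) (j : Fin (k i)), (j : ℕ) + 1 = k i → a i j = 0)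
    (ha_ne : ∀ (i : Fin m) (j : Fin (k i)), (j : ℕ) + 1 < k i → a i j ≠ 0)
    (b : Fin n → ℂ) :
    -- the case in which the last weight of `B` is zero
    ((∀ j : Fin n, (j : ℕ) + 1 = n → b j = 0) →
      (UnitarilyEquivalent (weightedShift b) (matrixDirectSum hn fun i => weightedShift (a i)) ↔
        ∃ τ : Equiv.Perm (Fin m),
          entrywiseAbs (weightedShift b) =
            matrixDirectSum ((Equiv.sum_comp τ k).trans hn)
              fun i => entrywiseAbs (weightedShift (a (τ i))))) ∧
    -- arbitrary `B`: the same after a rotation of its weights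
    (UnitarilyEquivalent (weightedShift b) (matrixDirectSum hn fun i => weightedShift (a i)) ↔
      ∃ (s : Fin n) (τ : Equiv.Perm (Fin m)),
        entrywiseAbs (weightedShift (rotateWeights b s)) =
          matrixDirectSum ((Equiv.sum_comp τ k).trans hn)
            fun i => entrywiseAbs (weightedShift (a (τ i)))) := by
  have : NeZero n := ⟨by
    have h1 := Finset.single_le_sum (fun i _ => Nat.zero_le (k i))
      (Finset.mem_univ (⟨0, by omega⟩ : Fin m))
    have h2 := hk ⟨0, by omega⟩
    omega⟩
  have habs : ∀ (b : Fin n → ℂ) (τ : Equiv.Perm (Fin m)), entrywiseAbs (weightedShift b) =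
      matrixDirectSum ((Equiv.sum_comp τ k).trans hn)
        (fun i => entrywiseAbs (weightedShift (a (τ i)))) ↔
      ∀ x, ‖b x‖ = ‖concatWeights ((Equiv.sum_comp τ k).trans hn) (fun i => a (τ i)) x‖ :=
    fun b τ => entrywiseAbs_eq_matrixDirectSum_iff _ (fun i => ha_last (τ i)) b
  simp only [habs]
  refine ⟨fun hb => unitarilyEquivalent_matrixDirectSum_iff hn hk ha_last ha_ne hb,
    ?_, ?_⟩
  · intro hU
    -- B has as many zero weights as A has blocks, hence at least one; rotation by `s` puts it last.
    obtain ⟨s, hs⟩ : ∃ s, b (s - 1) = 0 := by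
      have hU' := hU
      rw [matrixDirectSum_weightedShift hn ha_last] at hU'
      obtain ⟨φ, -⟩ := exists_equiv_profile_eq hU' 0
      obtain ⟨γ, -⟩ := exists_equiv_blockStart hn hk ha_last ha_ne
      exact ⟨_, (φ.symm (γ ⟨0, by omega⟩)).2⟩
    have hb : ∀ j : Fin n, (j : ℕ) + 1 = n → rotateWeights b s j = 0 := by
      intro j hj
      have h0 : j + 1 = 0 := by
        rw [Fin.ext_iff, Fin.val_add_one_mod, hj, Nat.mod_self, Fin.val_zero]
      rw [rotateWeights_apply, eq_neg_of_add_eq_zero_left h0, neg_add_eq_sub, hs]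
    exact ⟨s, (unitarilyEquivalent_matrixDirectSum_iff hn hk ha_last ha_ne hb).1
      ((weightedShift_rotateWeights_unitarilyEquivalent b s).trans hU)⟩
  · rintro ⟨s, τ, hτ⟩
    refine (weightedShift_rotateWeights_unitarilyEquivalent b s).symm.trans
      ((unitarilyEquivalent_matrixDirectSum_iff hn hk ha_last ha_ne ?_).2 ⟨τ, hτ⟩)
    -- The last rotated weight is zero because its modulus is that of the last weight of a block.
    intro j hj
    rw [← norm_eq_zero, hτ, concatWeights_last _ (fun i => ha_last (τ i)) j hj, norm_zero]
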